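/- A source multicasts updates to $n$ nodes; nodes $1,\dots,k$ ($1\le k<n$) have priority. Update $j\ge 1$ is generated at time $T_{j-1}$ (with $T_0=0$) and needs the service time $X_{ij}$ to reach node $i$. As soon as it has reached all priority nodes, that is, at $T_j=T_{j-1}+Y_j$ with $Y_j=\max(X_{1j},\dots,X_{kj})$, its transmission to all other nodes is terminated and update $j+1$ is generated; so update $j$ reaches a non-priority node $i$, at time $T_{j-1}+X_{ij}$, if and only if $X_{ij}\le Y_j$. The $X_{ij}$ are i.i.d. copies of a nonnegative random variable $X$ with continuous distribution function and $E[X^2]<\infty$. The age at node $i$ at time $t$ is $\Delta_i(t)=t-u_i(t)$, where $u_i(t)$ is the time stamp (generation time) of the most recently generated update that node $i$ has received by time $t$; the age at time $0$ is an arbitrary nonnegative number (possibly random). Then for every non-priority node $i$, almost surely $\Delta_i$ is integrable on every interval $[0,\tau]$, and the time average $\lim_{\tau\to\infty}\frac1\tau\int_0^\tau\Delta_i(t)\,dt$ exists and equals $$\Delta_E=\frac1k\sum_{l=1}^{k}E[X_{l:k+1}]+\delta_1(k)+\delta_2(k),$$ where $$\delta_1(k)=\frac{\operatorname{Var}[X_{k:k+1}]+k\operatorname{Var}[X_{k+1:k+1}]}{2(k+1)E[X_{k:k}]},$$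 $$\delta_2(k)=\frac{\frac{k+2}{k}E[X_{k:k+1}]^2+k\,E[X_{k+1:k+1}]^2+2E[X_{k+1:k+1}]E[X_{k:k+1}]}{2(k+1)E[X_{k:k}]},$$ and $X_{l:m}$ denotes the $l$-th smallest of $m$ independent copies of $X$. -/

import Mathlib

open MeasureTheory ProbabilityTheory Filter Topology

noncomputable section

namespace Multicast

/-! ### Order statistics -/

/-- The `i`-th order statistic (the `i`-th smallest entry, `1 ≤ i ≤ m`) of `x₁, …, x_m`.
`Tuple.sort x` is the permutation that sorts the entries of `x` in increasing order.
The value for `i` outside `{1, …, m}` is never used. -/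
def orderStat {m : ℕ} (i : ℕ) (x : Fin m → ℝ) : ℝ :=
  if h : 1 ≤ i ∧ i ≤ m then x (Tuple.sort x ⟨i - 1, by omega⟩) else 0

/-- `E[X_{i:m}]`: the mean of the `i`-th order statistic of `m` i.i.d. variables of law `μ`. -/
def eos (μ : Measure ℝ) (i m : ℕ) : ℝ :=
  ∫ x, orderStat i x ∂(Measure.pi fun _ : Fin m => μ)

/-- `Var[X_{i:m}]`: the variance of the `i`-th order statistic of `m` i.i.d. variables of
law `μ`. -/
def varos (μ : Measure ℝ) (i m : ℕ) : ℝ :=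
  variance (fun x : Fin m → ℝ => orderStat i x) (Measure.pi fun _ : Fin m => μ)

/-! ### The multicast system along one sample path

There are `n` nodes `0, …, n - 1`, and the priority nodes are those with index `< k`. Updates are
numbered `0, 1, 2, …`, and `x i j` is the service time of update `j` at node `i`. -/

/-- The service interval of update `j`: the time until all priority nodes have received it. -/
def serviceInterval {n : ℕ} (k : ℕ) (x : Fin n → ℕ → ℝ) (j : ℕ) : ℝ :=
  ⨆ i : {i : Fin n // (i : ℕ) < k}, x i.1 j

/-- The time at which update `j` is generated (its time stamp): update `0` is generated at time
`0`, every later one as soon as its predecessor has reached all priority nodes. -/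
def stamp {n : ℕ} (k : ℕ) (x : Fin n → ℕ → ℝ) (j : ℕ) : ℝ :=
  ∑ l ∈ Finset.range j, serviceInterval k x l

/-- Update `j` reaches node `i`, that is, its service there is not terminated by the end of the
service interval. A priority node receives every update. -/
def Delivered {n : ℕ} (k : ℕ) (x : Fin n → ℕ → ℝ) (i : Fin n) (j : ℕ) : Prop :=
  x i j ≤ serviceInterval k x j

/-- The time stamp `u_i(t)` of the most recent update that node `i` has received by time `t`, when
the node holds an update with time stamp `-a` at time `0`. -/
def lastStamp {n : ℕ} (k : ℕ) (x : Fin n → ℕ → ℝ) (a : ℝ) (i : Fin n) (t : ℝ) : ℝ :=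
  sSup (insert (-a)
    {s | ∃ j : ℕ, Delivered k x i j ∧ stamp k x j + x i j ≤ t ∧ s = stamp k x j})

/-- The age `t - u_i(t)` at node `i` at time `t`, when the age at time `0` is `a`. -/
def age {n : ℕ} (k : ℕ) (x : Fin n → ℕ → ℝ) (a : ℝ) (i : Fin n) (t : ℝ) : ℝ :=
  t - lastStamp k x a i t

/-! ### The terms of the formula -/

/-- The term `δ₁(k)`. -/
def delta1 (μ : Measure ℝ) (k : ℕ) : ℝ :=
  (varos μ k (k + 1) + k * varos μ (k + 1) (k + 1)) / (2 * (k + 1) * eos μ k k)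

/-- The term `δ₂(k)`. -/
def delta2 (μ : Measure ℝ) (k : ℕ) : ℝ :=
  (((k : ℝ) + 2) / k * eos μ k (k + 1) ^ 2 + k * eos μ (k + 1) (k + 1) ^ 2
      + 2 * eos μ (k + 1) (k + 1) * eos μ k (k + 1)) / (2 * (k + 1) * eos μ k k)

end Multicast

end

namespace Multicast

/-! Let `A j` be the age at node `i` when update `j` is generated, `Y j` the service interval, and
`d j` the indicator of delivery. A delivery resets the age to the time since the stamp, so `A (j+1)
= Y j + (1 - d j) * A j`, and the age curve over cycle `j` has area `Y j ^ 2 / 2 + A j * min (X i j)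
(Y j)` (`hasIntegral_age_cycle`). The time average is the mean area over the mean cycle length.

`A j` depends only on earlier updates, hence is independent of update `j`. The recursion telescopes
to give `A` the long-run mean `E[Y] / q` with `q = E[d] = k / (k + 1)`. So the limit is `(E[Y²] / 2
+ E[min(X, Y)] * E[Y] / q) / E[Y]`. Since the `A j` are not i.i.d., their averages are handled
through orthogonal martingale differences with bounded second moments: these give convergence along
the squares (`ae_tendsto_sum_ageAtStamp_mul`), and nonnegativity of the age fills the gaps
(`tendsto_average_of_tendsto_subseq`).

The expectations involve one entry of a sample of size `k + 1` and the maximum of the others. By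
exchangeability the distinguished entry is equally likely to have any rank, which brings in the
order statistics (`integral_comp_maxOthers_last`, `average_age_eq`). -/

/-- The largest of the entries of `x` other than `x p`. -/
noncomputable def maxOthers {k : ℕ} (p : Fin (k + 1)) (x : Fin (k + 1) → ℝ) : ℝ :=
  ⨆ r : Fin k, x (p.succAbove r)

/-! ### Order statistics and the maximum of all entries but one -/

section Pointwise

theorem orderStat_succ {m : ℕ} (l : Fin m) (x : Fin m → ℝ) :
    orderStat (l + 1) x = x (Tuple.sort x l) := by
  rw [orderStat, dif_pos ⟨by omega, by omega⟩]
  rfl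

theorem orderStat_mono {m i j : ℕ} (hi : 1 ≤ i) (hij : i ≤ j) (hj : j ≤ m) (x : Fin m → ℝ) :
    orderStat i x ≤ orderStat j x := by
  rw [orderStat, orderStat, dif_pos ⟨hi, by omega⟩, dif_pos ⟨by omega, hj⟩]
  exact Tuple.monotone_sort x (Fin.mk_le_mk.2 (by omega))

theorem abs_orderStat_le {m : ℕ} (i : ℕ) (x : Fin m → ℝ) : |orderStat i x| ≤ ∑ r, |x r| := by
  unfold orderStat
  split_ifs
  · exact Finset.single_le_sum (f := fun r => |x r|) (fun r _ => abs_nonneg _) (Finset.mem_univ _)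
  · rw [abs_zero]
    exact Finset.sum_nonneg fun r _ => abs_nonneg _

theorem iSup_eq_orderStat {k : ℕ} (hk : 1 ≤ k) (x : Fin k → ℝ) : ⨆ r, x r = orderStat k x := by
  obtain ⟨k, rfl⟩ := Nat.exists_eq_add_of_le' hk
  have h := orderStat_succ (Fin.last k) x
  rw [Fin.val_last] at h
  rw [h]
  refine le_antisymm (ciSup_le fun r => ?_) (le_ciSup (Finite.bddAbove_range x) _)
  obtain ⟨l, rfl⟩ := (Tuple.sort x).surjective r
  exact Tuple.monotone_sort x (Fin.le_last l)

variable {k : ℕ}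

theorem le_maxOthers {p q : Fin (k + 1)} (h : q ≠ p) (x : Fin (k + 1) → ℝ) :
    x q ≤ maxOthers p x := by
  obtain ⟨r, rfl⟩ := Fin.exists_succAbove_eq h
  exact le_ciSup (f := fun r => x (p.succAbove r)) (Set.finite_range _).bddAbove r

theorem maxOthers_le (hk : 1 ≤ k) {p : Fin (k + 1)} {x : Fin (k + 1) → ℝ} {c : ℝ}
    (h : ∀ q, q ≠ p → x q ≤ c) : maxOthers p x ≤ c := by
  have : Nonempty (Fin k) := ⟨⟨0, hk⟩⟩
  exact ciSup_le fun r => h _ (Fin.succAbove_ne p r)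

theorem maxOthers_sort_last (hk : 1 ≤ k) (x : Fin (k + 1) → ℝ) :
    maxOthers (Tuple.sort x (Fin.last k)) x = orderStat k x := by
  have h : orderStat k x = x (Tuple.sort x ⟨k - 1, by omega⟩) := by
    rw [orderStat, dif_pos ⟨hk, by omega⟩]
  rw [h]
  refine le_antisymm (maxOthers_le hk fun q hq => ?_) (le_maxOthers ?_ x)
  · obtain ⟨l, rfl⟩ := (Tuple.sort x).surjective q
    refine Tuple.monotone_sort x (Fin.mk_le_mk.2 ?_)
    have hl : l ≠ Fin.last k := fun h => hq (by rw [h])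
    have := Fin.val_lt_last hl
    omega
  · rw [ne_eq, (Tuple.sort x).injective.eq_iff, Fin.ext_iff, Fin.val_last]
    change ¬ k - 1 = k
    omega

theorem maxOthers_sort_castSucc (hk : 1 ≤ k) (x : Fin (k + 1) → ℝ) (l : Fin k) :
    maxOthers (Tuple.sort x l.castSucc) x = orderStat (k + 1) x := by
  have h := orderStat_succ (Fin.last k) x
  rw [Fin.val_last] at h
  rw [h]
  refine le_antisymm (maxOthers_le hk fun q _ => ?_) (le_maxOthers ?_ x)
  · obtain ⟨l, rfl⟩ := (Tuple.sort x).surjective q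
    exact Tuple.monotone_sort x (Fin.le_last l)
  · rw [ne_eq, (Tuple.sort x).injective.eq_iff]
    exact (Fin.castSucc_lt_last l).ne'

/-- Summing over ranks instead of positions: removing an entry leaves the maximum unchanged unless
the removed entry is the one sorted last. Ties are harmless, as positions are removed and not
values. -/
theorem sum_comp_maxOthers (hk : 1 ≤ k) (F : ℝ → ℝ → ℝ) (x : Fin (k + 1) → ℝ) :
    ∑ p, F (x p) (maxOthers p x) =
      ∑ l : Fin k, F (orderStat (l + 1) x) (orderStat (k + 1) x) +
        F (orderStat (k + 1) x) (orderStat k x) := by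
  rw [← Equiv.sum_comp (Tuple.sort x), Fin.sum_univ_castSucc, maxOthers_sort_last hk,
    ← orderStat_succ (Fin.last k) x, Fin.val_last]
  congr 1
  refine Finset.sum_congr rfl fun l _ => ?_
  rw [maxOthers_sort_castSucc hk, ← orderStat_succ l.castSucc x, Fin.val_castSucc]

theorem abs_maxOthers_le (hk : 1 ≤ k) (p : Fin (k + 1)) (x : Fin (k + 1) → ℝ) :
    |maxOthers p x| ≤ ∑ r, |x r| := by
  have : Nonempty (Fin k) := ⟨⟨0, hk⟩⟩
  obtain ⟨r, hr⟩ := exists_eq_ciSup_of_finite (f := fun r : Fin k => x (p.succAbove r))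
  rw [maxOthers, ← hr]
  exact Finset.single_le_sum (f := fun r => |x r|) (fun r _ => abs_nonneg _) (Finset.mem_univ _)

end Pointwise

/-! ### Measurability and square integrability -/

section Measurability

theorem measurable_orderStat {m : ℕ} (i : ℕ) :
    Measurable fun x : Fin m → ℝ => orderStat i x := by
  by_cases h : 1 ≤ i ∧ i ≤ m
  · refine measurable_of_Iic fun c => ?_
    -- Any permutation that sorts `x` yields the same sorted tuple, so `Tuple.sort x` may be
    -- replaced by a finite union over all permutations.
    have hset : (fun x : Fin m → ℝ => orderStat i x) ⁻¹' Set.Iic c =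
        ⋃ σ : Equiv.Perm (Fin m), {x | Monotone (x ∘ σ)} ∩ {x | x (σ ⟨i - 1, by omega⟩) ≤ c} := by
      ext x
      simp only [Set.mem_preimage, Set.mem_Iic, Set.mem_iUnion, Set.mem_inter_iff,
        Set.mem_ofPred_eq, orderStat, dif_pos h]
      refine ⟨fun hx => ⟨Tuple.sort x, Tuple.monotone_sort x, hx⟩, ?_⟩
      rintro ⟨σ, hσ, hx⟩
      have := congr_fun (Tuple.comp_sort_eq_comp_iff_monotone.2 hσ) ⟨i - 1, by omega⟩
      simp only [Function.comp_apply] at this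
      rwa [← this]
    rw [hset]
    refine MeasurableSet.iUnion fun σ => MeasurableSet.inter ?_ ?_
    · have : Continuous fun x : Fin m → ℝ => x ∘ σ := by fun_prop
      exact (isClosed_monotone.preimage this).measurableSet
    · exact measurableSet_le (measurable_pi_apply _) measurable_const
  · simp only [orderStat, dif_neg h]
    exact measurable_const

variable {k : ℕ}

theorem measurable_maxOthers (p : Fin (k + 1)) : Measurable (maxOthers p) :=
  Measurable.iSup fun _ => measurable_pi_apply _

variable {μ : Measure ℝ} [IsProbabilityMeasure μ]

theorem memLp_sum_abs {m : ℕ} (hμ : MemLp id 2 μ) :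
    MemLp (fun x : Fin m → ℝ => ∑ r, |x r|) 2 (Measure.pi fun _ => μ) :=
  memLp_finsetSum _ fun r _ =>
    (hμ.comp_measurePreserving (measurePreserving_eval (fun _ : Fin m => μ) r)).norm

theorem memLp_orderStat {m : ℕ} (hμ : MemLp id 2 μ) (i : ℕ) :
    MemLp (fun x : Fin m → ℝ => orderStat i x) 2 (Measure.pi fun _ => μ) :=
  (memLp_sum_abs hμ).mono' (measurable_orderStat i).aestronglyMeasurable
    (ae_of_all _ fun x => abs_orderStat_le i x)

theorem memLp_maxOthers (hμ : MemLp id 2 μ) (hk : 1 ≤ k) (p : Fin (k + 1)) :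
    MemLp (maxOthers p) 2 (Measure.pi fun _ => μ) :=
  (memLp_sum_abs hμ).mono' (measurable_maxOthers p).aestronglyMeasurable
    (ae_of_all _ fun x => abs_maxOthers_le hk p x)

end Measurability

/-! ### Expectations through exchangeability -/

section Expectation

variable {k : ℕ} {μ : Measure ℝ} [IsProbabilityMeasure μ]

theorem measurePreserving_comp_perm {m : ℕ} (σ : Equiv.Perm (Fin m)) :
    MeasurePreserving (fun x : Fin m → ℝ => x ∘ σ) (Measure.pi fun _ => μ)
      (Measure.pi fun _ => μ) := by
  convert! measurePreserving_piCongrLeft (fun _ : Fin m => μ) σ.symm using 1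
  ext x i
  simp [MeasurableEquiv.piCongrLeft, Equiv.piCongrLeft]

theorem integral_comp_maxOthers (F : ℝ → ℝ → ℝ) (hF : Measurable (Function.uncurry F))
    (p : Fin (k + 1)) :
    ∫ x, F (x p) (maxOthers p x) ∂(Measure.pi fun _ : Fin (k + 1) => μ) =
      ∫ x, F (x (Fin.last k)) (maxOthers (Fin.last k) x)
        ∂(Measure.pi fun _ : Fin (k + 1) => μ) := by
  -- Sends the last position to `p` and matches the remaining positions in order.
  let σ : Equiv.Perm (Fin (k + 1)) := (finSuccEquiv' (Fin.last k)).trans (finSuccEquiv' p).symm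
  have hm : Measurable fun x : Fin (k + 1) → ℝ =>
      F (x (Fin.last k)) (maxOthers (Fin.last k) x) :=
    hF.comp ((measurable_pi_apply _).prodMk (measurable_maxOthers _))
  have hσ := measurePreserving_comp_perm (μ := μ) σ
  conv_rhs => rw [← hσ.map_eq]
  rw [integral_map hσ.measurable.aemeasurable hm.aestronglyMeasurable]
  congr 1 with x
  have h1 : σ (Fin.last k) = p := by simp [σ]
  have h2 : ∀ r, σ ((Fin.last k).succAbove r) = p.succAbove r := fun r => by
    simp only [σ, Equiv.trans_apply, finSuccEquiv'_succAbove, finSuccEquiv'_symm_some]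
  simp only [maxOthers, Function.comp_apply, h1, h2]

/-- By exchangeability, a mean over one entry and the maximum of the others is an average over the
order statistics. -/
theorem integral_comp_maxOthers_last (hk : 1 ≤ k) (F : ℝ → ℝ → ℝ)
    (hF : Measurable (Function.uncurry F))
    (hi : ∀ p, Integrable (fun x : Fin (k + 1) → ℝ => F (x p) (maxOthers p x))
      (Measure.pi fun _ => μ)) :
    ((k : ℝ) + 1) * ∫ x, F (x (Fin.last k)) (maxOthers (Fin.last k) x)
        ∂(Measure.pi fun _ : Fin (k + 1) => μ) =
      ∫ x, (∑ l : Fin k, F (orderStat (l + 1) x) (orderStat (k + 1) x) +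
        F (orderStat (k + 1) x) (orderStat k x)) ∂(Measure.pi fun _ : Fin (k + 1) => μ) := by
  simp_rw [← sum_comp_maxOthers hk F]
  rw [integral_finsetSum _ fun p _ => hi p]
  simp_rw [integral_comp_maxOthers F hF]
  simp

theorem integral_maxOthers (hμ : MemLp id 2 μ) (hk : 1 ≤ k) :
    ((k : ℝ) + 1) * ∫ x, maxOthers (Fin.last k) x ∂(Measure.pi fun _ : Fin (k + 1) => μ) =
      k * eos μ (k + 1) (k + 1) + eos μ k (k + 1) := by
  have h := integral_comp_maxOthers_last (μ := μ) hk (fun _ b => b) measurable_snd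
    fun p => (memLp_maxOthers hμ hk p).integrable one_le_two
  simp only [Finset.sum_const, Finset.card_univ, Fintype.card_fin, nsmul_eq_mul] at h
  rw [h, integral_add (((memLp_orderStat hμ _).integrable one_le_two).const_mul _)
    ((memLp_orderStat hμ _).integrable one_le_two), integral_const_mul]
  rfl

theorem integral_orderStat_sq {m : ℕ} (hμ : MemLp id 2 μ) (i : ℕ) :
    ∫ x : Fin m → ℝ, orderStat i x ^ 2 ∂(Measure.pi fun _ => μ) =
      varos μ i m + eos μ i m ^ 2 := by
  have h := variance_eq_sub (memLp_orderStat (m := m) hμ i)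
  simp only [varos, eos, h, Pi.pow_apply]
  ring

theorem integral_maxOthers_sq (hμ : MemLp id 2 μ) (hk : 1 ≤ k) :
    ((k : ℝ) + 1) * ∫ x, maxOthers (Fin.last k) x ^ 2 ∂(Measure.pi fun _ : Fin (k + 1) => μ) =
      k * (varos μ (k + 1) (k + 1) + eos μ (k + 1) (k + 1) ^ 2) +
        (varos μ k (k + 1) + eos μ k (k + 1) ^ 2) := by
  have h := integral_comp_maxOthers_last (μ := μ) hk (fun _ b => b ^ 2) (measurable_snd.pow_const 2)
    fun p => (memLp_maxOthers hμ hk p).integrable_sq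
  simp only [Finset.sum_const, Finset.card_univ, Fintype.card_fin, nsmul_eq_mul] at h
  rw [h, integral_add ((memLp_orderStat hμ _).integrable_sq.const_mul _)
    (memLp_orderStat hμ _).integrable_sq, integral_const_mul, integral_orderStat_sq hμ,
    integral_orderStat_sq hμ]

theorem memLp_min_maxOthers (hμ : MemLp id 2 μ) (hk : 1 ≤ k) (p : Fin (k + 1)) :
    MemLp (fun x => min (x p) (maxOthers p x)) 2 (Measure.pi fun _ => μ) :=
  (memLp_sum_abs hμ).mono'
    ((measurable_pi_apply p).min (measurable_maxOthers p)).aestronglyMeasurable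
    (ae_of_all _ fun x => by
      rw [Real.norm_eq_abs]
      rcases min_choice (x p) (maxOthers p x) with h | h <;> rw [h]
      · exact Finset.single_le_sum (f := fun r => |x r|) (fun r _ => abs_nonneg _)
          (Finset.mem_univ _)
      · exact abs_maxOthers_le hk p x)

/-- The minimum is the distinguished entry unless that entry ranks last, when it is the `k`-th order
statistic; hence the latter occurs twice. -/
theorem integral_min_maxOthers (hμ : MemLp id 2 μ) (hk : 1 ≤ k) :
    ((k : ℝ) + 1) * ∫ x, min (x (Fin.last k)) (maxOthers (Fin.last k) x)
        ∂(Measure.pi fun _ : Fin (k + 1) => μ) =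
      ∑ l ∈ Finset.Icc 1 k, eos μ l (k + 1) + eos μ k (k + 1) := by
  have h := integral_comp_maxOthers_last (μ := μ) hk min (measurable_fst.min measurable_snd)
    fun p => (memLp_min_maxOthers hμ hk p).integrable one_le_two
  have h1 : ∀ (l : Fin k) (x : Fin (k + 1) → ℝ),
      min (orderStat (l + 1) x) (orderStat (k + 1) x) = orderStat (l + 1) x := fun l x =>
    min_eq_left (orderStat_mono (by omega) (by omega) le_rfl x)
  have h2 : ∀ x : Fin (k + 1) → ℝ, min (orderStat (k + 1) x) (orderStat k x) = orderStat k x :=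
    fun x => min_eq_right (orderStat_mono hk (by omega) le_rfl x)
  simp only [h1, h2] at h
  have hi : ∀ i, Integrable (fun x : Fin (k + 1) → ℝ => orderStat i x) (Measure.pi fun _ => μ) :=
    fun i => (memLp_orderStat hμ i).integrable one_le_two
  rw [h, integral_add (integrable_finsetSum _ fun l _ => hi _) (hi _),
    integral_finsetSum _ fun l _ => hi _]
  congr 1
  change ∑ l : Fin k, eos μ (l + 1) (k + 1) = _
  rw [Fin.sum_univ_eq_sum_range (fun l => eos μ (l + 1) (k + 1)), Finset.range_eq_Ico,
    Finset.sum_Ico_add' (fun l => eos μ l (k + 1)) 0 k 1]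
  rfl

/-- Fubini: once the other entries are fixed, `x p` would have to hit a single point, which has
measure zero. -/
theorem ae_ne_maxOthers [NullSingletonClass μ] (p : Fin (k + 1)) :
    ∀ᵐ x ∂(Measure.pi fun _ : Fin (k + 1) => μ), x p ≠ maxOthers p x := by
  have h := measurePreserving_piFinSuccAbove (fun _ : Fin (k + 1) => μ) p
  have hmeas : Measurable fun z : Fin k → ℝ => ⨆ r, z r :=
    Measurable.iSup fun _ => measurable_pi_apply _
  have hprod : ∀ᵐ z ∂(μ.prod (Measure.pi fun _ : Fin k => μ)), z.1 ≠ ⨆ r, z.2 r := by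
    have hset : MeasurableSet {z : ℝ × (Fin k → ℝ) | z.1 = ⨆ r, z.2 r} :=
      measurableSet_eq_fun measurable_fst (hmeas.comp measurable_snd)
    rw [ae_iff]
    simp only [ne_eq, not_not]
    rw [Measure.prod_apply_symm hset]
    refine (lintegral_congr fun z => ?_).trans lintegral_zero
    have : (fun s => (s, z)) ⁻¹' {z : ℝ × (Fin k → ℝ) | z.1 = ⨆ r, z.2 r} = {⨆ r, z r} := by
      ext s; simp
    rw [this, measure_singleton]
  exact h.quasiMeasurePreserving.ae hprod

theorem integrable_indicator_le_maxOthers (p : Fin (k + 1)) :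
    Integrable (fun x => if x p ≤ maxOthers p x then (1 : ℝ) else 0)
      (Measure.pi fun _ : Fin (k + 1) => μ) := by
  refine Integrable.of_bound (Measurable.ite (measurableSet_le (measurable_pi_apply p)
    (measurable_maxOthers p)) measurable_const measurable_const).aestronglyMeasurable 1
    (ae_of_all _ fun x => ?_)
  split_ifs <;> simp

/-- The probability that an entry is not the largest one. -/
theorem integral_indicator_le_maxOthers [NullSingletonClass μ] (hk : 1 ≤ k) :
    ((k : ℝ) + 1) * ∫ x, (if x (Fin.last k) ≤ maxOthers (Fin.last k) x then (1 : ℝ) else 0)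
      ∂(Measure.pi fun _ : Fin (k + 1) => μ) = k := by
  have h := integral_comp_maxOthers_last (μ := μ) hk (fun s b => if s ≤ b then 1 else 0)
    (Measurable.ite (measurableSet_le measurable_fst measurable_snd) measurable_const
      measurable_const) integrable_indicator_le_maxOthers
  rw [h]
  -- A tie at the top would make all `k + 1` ranks count instead of `k`; continuity of the law
  -- excludes it.
  have hae : ∀ᵐ x ∂(Measure.pi fun _ : Fin (k + 1) => μ), ∀ p, x p ≠ maxOthers p x :=
    ae_all_iff.2 ae_ne_maxOthers
  refine (integral_congr_ae (g := fun _ => (k : ℝ)) ?_).trans (by simp)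
  filter_upwards [hae] with x hx
  have h1 : ∀ l : Fin k, orderStat (l + 1) x ≤ orderStat (k + 1) x := fun l =>
    orderStat_mono (by omega) (by omega) le_rfl x
  have h2 : ¬ orderStat (k + 1) x ≤ orderStat k x := fun hle => by
    have he := le_antisymm hle (orderStat_mono hk (by omega) le_rfl x)
    refine hx (Tuple.sort x (Fin.last k)) ?_
    rw [maxOthers_sort_last hk, ← orderStat_succ (Fin.last k) x, Fin.val_last, he]
  simp [h1, h2]

theorem eos_self (hk : 1 ≤ k) :
    eos μ k k = ∫ x, maxOthers (Fin.last k) x ∂(Measure.pi fun _ : Fin (k + 1) => μ) := by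
  have h : MeasurePreserving (fun (x : Fin (k + 1) → ℝ) r => x ((Fin.last k).succAbove r))
      (Measure.pi fun _ => μ) (Measure.pi fun _ : Fin k => μ) :=
    measurePreserving_snd.comp (measurePreserving_piFinSuccAbove (fun _ => μ) (Fin.last k))
  rw [eos, ← h.map_eq, integral_map h.measurable.aemeasurable
    (measurable_orderStat k).aestronglyMeasurable]
  simp_rw [← iSup_eq_orderStat hk]
  rfl

theorem eos_self_pos [NullSingletonClass μ] (hμ₀ : ∀ᵐ s ∂μ, 0 ≤ s) (hμ : MemLp id 2 μ)
    (hk : 1 ≤ k) : 0 < eos μ k k := by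
  rw [eos_self hk]
  set r : Fin (k + 1) := (⟨0, hk⟩ : Fin k).castSucc with hr
  have hr' : r ≠ Fin.last k := (Fin.castSucc_lt_last _).ne
  have hev := (measurePreserving_eval (fun _ : Fin (k + 1) => μ) r).quasiMeasurePreserving
  have h0 : ∀ᵐ x ∂(Measure.pi fun _ : Fin (k + 1) => μ), 0 ≤ x r := hev.ae hμ₀
  have h1 : ∀ᵐ x ∂(Measure.pi fun _ : Fin (k + 1) => μ), x r ≠ 0 := 
    hev.ae (compl_mem_ae_iff.2 (measure_singleton 0))
  have hnn : 0 ≤ᵐ[Measure.pi fun _ : Fin (k + 1) => μ] maxOthers (Fin.last k) := by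
    filter_upwards [h0] with x hx using hx.trans (le_maxOthers hr' x)
  refine lt_of_le_of_ne (integral_nonneg_of_ae hnn) fun h => ?_
  have hz := (integral_eq_zero_iff_of_nonneg_ae hnn
    ((memLp_maxOthers hμ hk _).integrable one_le_two)).1 h.symm
  obtain ⟨x, hx0, hx1, hx⟩ := (h0.and (h1.and hz)).exists
  exact hx1 (le_antisymm ((le_maxOthers hr' x).trans_eq hx) hx0)

theorem average_age_eq [NullSingletonClass μ] (hμ₀ : ∀ᵐ s ∂μ, 0 ≤ s) (hμ : MemLp id 2 μ)
    (hk : 1 ≤ k) :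
    ((∫ x, maxOthers (Fin.last k) x ^ 2 ∂(Measure.pi fun _ : Fin (k + 1) => μ)) / 2 +
      (∫ x, min (x (Fin.last k)) (maxOthers (Fin.last k) x)
        ∂(Measure.pi fun _ : Fin (k + 1) => μ)) *
      ((∫ x, maxOthers (Fin.last k) x ∂(Measure.pi fun _ : Fin (k + 1) => μ)) /
        ∫ x, (if x (Fin.last k) ≤ maxOthers (Fin.last k) x then (1 : ℝ) else 0)
          ∂(Measure.pi fun _ : Fin (k + 1) => μ))) /
      (∫ x, maxOthers (Fin.last k) x ∂(Measure.pi fun _ : Fin (k + 1) => μ)) =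
    1 / (k : ℝ) * ∑ l ∈ Finset.Icc 1 k, eos μ l (k + 1) + delta1 μ k + delta2 μ k := by
  have hpos := eos_self_pos hμ₀ hμ hk
  have h1 := integral_maxOthers hμ hk
  have h2 := integral_maxOthers_sq hμ hk
  have h3 := integral_min_maxOthers hμ hk
  have h4 := integral_indicator_le_maxOthers (μ := μ) hk
  rw [delta1, delta2, eos_self hk]
  rw [eos_self hk] at hpos
  set S := ∑ l ∈ Finset.Icc 1 k, eos μ l (k + 1)
  set u := eos μ k (k + 1)
  set v := eos μ (k + 1) (k + 1)
  set m := ∫ x, maxOthers (Fin.last k) x ∂(Measure.pi fun _ : Fin (k + 1) => μ)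
  have hk0 : (0 : ℝ) < k := by exact_mod_cast hk
  have hk1 : (k : ℝ) + 1 ≠ 0 := by positivity
  rw [eq_div_of_mul_eq hk1 ((mul_comm _ _).trans h2), eq_div_of_mul_eq hk1 ((mul_comm _ _).trans h3),
    eq_div_of_mul_eq hk1 ((mul_comm _ _).trans h4)]
  field_simp
  -- Here `E[min] / q = (S + u) / k`. The part `S / k` is the first term of the formula; `u / k`,
  -- put over the denominator `2 * (k + 1) * m` by means of `h1`, gives the mixed product and the
  -- excess `2 / k` in the coefficient of `u ^ 2`.
  linear_combination 2 * u * h1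

end Expectation

/-- The age just after the generation of the `j`-th update, when the service intervals are `y` and
`d j` is `1` if update `j` is delivered and `0` if not. -/
def ageAtStamp (y d : ℕ → ℝ) (a : ℝ) : ℕ → ℝ
  | 0 => a
  | j + 1 => y j + (1 - d j) * ageAtStamp y d a j

/-! ### Almost sure convergence from second moments -/

section SquareIntegrable

variable {Ω : Type*} [MeasurableSpace Ω] {P : Measure Ω}

/-- The series of squares has finite expectation, so it converges almost surely and its terms vanish
in the limit. -/
theorem ae_tendsto_zero_of_summable_integral_sq {R : ℕ → Ω → ℝ} (hR : ∀ n, MemLp (R n) 2 P)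
    (hs : Summable fun n => ∫ ω, R n ω ^ 2 ∂P) :
    ∀ᵐ ω ∂P, Tendsto (fun n => R n ω) atTop (𝓝 0) := by
  have hmeas : ∀ n, AEMeasurable (fun ω => ENNReal.ofReal (R n ω ^ 2)) P := fun n =>
    ((hR n).aestronglyMeasurable.aemeasurable.pow_const 2).ennreal_ofReal
  have hfin : ∫⁻ ω, ∑' n, ENNReal.ofReal (R n ω ^ 2) ∂P ≠ ⊤ := by
    rw [lintegral_tsum hmeas]
    have : ∀ n, ∫⁻ ω, ENNReal.ofReal (R n ω ^ 2) ∂P = ENNReal.ofReal (∫ ω, R n ω ^ 2 ∂P) := fun n =>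
      (ofReal_integral_eq_lintegral_ofReal (hR n).integrable_sq
        (ae_of_all _ fun ω => sq_nonneg _)).symm
    simp_rw [this]
    rw [← ENNReal.ofReal_tsum_of_nonneg (fun n => integral_nonneg fun ω => sq_nonneg _) hs]
    exact ENNReal.ofReal_ne_top
  filter_upwards [ae_lt_top' (AEMeasurable.tsum hmeas) hfin] with ω hω
  have h := ENNReal.tendsto_atTop_zero_of_tsum_ne_top hω.ne
  have h2 := (ENNReal.tendsto_toReal ENNReal.zero_ne_top).comp h
  have h3 : Tendsto (fun n => R n ω ^ 2) atTop (𝓝 0) := by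
    simpa [Function.comp_def, ENNReal.toReal_ofReal (sq_nonneg _)] using h2
  have h4 := h3.sqrt
  simp only [Real.sqrt_sq_eq_abs, Real.sqrt_zero] at h4
  exact (tendsto_zero_iff_abs_tendsto_zero _).2 h4

theorem integral_sq_sum_le_of_orthogonal {U : ℕ → Ω → ℝ} {K : ℝ} (hU : ∀ n, MemLp (U n) 2 P)
    (horth : ∀ i j, i < j → ∫ ω, U i ω * U j ω ∂P = 0) (hK : ∀ n, ∫ ω, U n ω ^ 2 ∂P ≤ K) (n : ℕ) :
    ∫ ω, (∑ j ∈ Finset.range n, U j ω) ^ 2 ∂P ≤ n * K := by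
  induction n with
  | zero => simp
  | succ n ih =>
    have hS : MemLp (fun ω => ∑ j ∈ Finset.range n, U j ω) 2 P :=
      memLp_finsetSum _ fun j _ => hU j
    have hcross : ∫ ω, (∑ j ∈ Finset.range n, U j ω) * U n ω ∂P = 0 := by
      simp_rw [Finset.sum_mul]
      have hi : ∀ j, Integrable (fun ω => U j ω * U n ω) P := fun j => (hU j).integrable_mul (hU n)
      rw [integral_finsetSum _ fun j _ => hi j]
      exact Finset.sum_eq_zero fun j hj => horth j n (Finset.mem_range.1 hj)
    have hexp : ∀ ω, (∑ j ∈ Finset.range (n + 1), U j ω) ^ 2 =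
        ((∑ j ∈ Finset.range n, U j ω) ^ 2 + 2 * ((∑ j ∈ Finset.range n, U j ω) * U n ω))
          + U n ω ^ 2 := fun ω => by
      rw [Finset.sum_range_succ]; ring
    have hi : Integrable (fun ω => (∑ j ∈ Finset.range n, U j ω) * U n ω) P :=
      hS.integrable_mul (hU n)
    have hi2 : Integrable (fun ω => (∑ j ∈ Finset.range n, U j ω) ^ 2 +
        2 * ((∑ j ∈ Finset.range n, U j ω) * U n ω)) P := hS.integrable_sq.add (hi.const_mul 2)
    simp_rw [hexp]
    rw [integral_add hi2 (hU n).integrable_sq,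
      integral_add hS.integrable_sq (hi.const_mul 2), integral_const_mul, hcross]
    push_cast
    linarith [hK n]

/-- A strong law of large numbers, along the squares, for orthogonal variables. -/
theorem ae_tendsto_sum_div_of_orthogonal {U : ℕ → Ω → ℝ} {K : ℝ} (hU : ∀ n, MemLp (U n) 2 P)
    (horth : ∀ i j, i < j → ∫ ω, U i ω * U j ω ∂P = 0) (hK : ∀ n, ∫ ω, U n ω ^ 2 ∂P ≤ K) :
    ∀ᵐ ω ∂P, Tendsto (fun n : ℕ => (∑ j ∈ Finset.range (n ^ 2), U j ω) / (n : ℝ) ^ 2)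
      atTop (𝓝 0) := by
  have hS : ∀ n : ℕ, MemLp (fun ω => ∑ j ∈ Finset.range (n ^ 2), U j ω) 2 P := fun n =>
    memLp_finsetSum _ fun j _ => hU j
  refine ae_tendsto_zero_of_summable_integral_sq (fun n => ?_) ?_
  · simpa only [div_eq_mul_inv] using (hS n).mul_const _
  -- The second moment of a sum of `n ^ 2` terms is at most `n ^ 2 * K`; after division by `n ^ 4`
  -- it is summable, which is the reason for the squares.
  · refine Summable.of_nonneg_of_le (fun n => integral_nonneg fun ω => sq_nonneg _) (fun n => ?_)
      ((Real.summable_one_div_nat_pow.2 one_lt_two).mul_left K)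
    simp_rw [div_pow]
    rw [integral_div]
    rcases Nat.eq_zero_or_pos n with rfl | hn
    · simp
    have hn' : (0 : ℝ) < n := by exact_mod_cast hn
    have := integral_sq_sum_le_of_orthogonal hU horth hK (n ^ 2)
    push_cast at this
    rw [div_le_iff₀ (by positivity)]
    calc _ ≤ _ := this
      _ = _ := by field_simp

end SquareIntegrable

/-! ### Long-run averages of the age recursion with i.i.d. input -/

section IID

variable {Ω E : Type*} {mΩ : MeasurableSpace Ω} [mE : MeasurableSpace E] {P : Measure Ω}

/-- The information carried by the variables `C l` with `l < n`. -/
abbrev past (C : ℕ → Ω → E) (n : ℕ) : MeasurableSpace Ω :=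
  ⨆ l ∈ Set.Iio n, mE.comap (C l)

theorem past_mono (C : ℕ → Ω → E) : Monotone (past C) := fun _ _ h =>
  biSup_mono fun _ hl => lt_of_lt_of_le hl h

theorem measurable_past_comp {C : ℕ → Ω → E} {l n : ℕ} (h : l < n) {w : E → ℝ}
    (hw : Measurable w) : Measurable[past C n] fun ω => w (C l ω) := by
  have h1 : Measurable[mE.comap (C l)] fun ω => w (C l ω) := hw.comp (comap_measurable _)
  exact h1.mono (le_iSup₂_of_le (f := fun l (_ : l ∈ Set.Iio n) => mE.comap (C l)) l h le_rfl) le_rfl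

theorem indepFun_of_measurable_past {C : ℕ → Ω → E} (hC : ∀ j, Measurable (C j))
    (hind : iIndepFun C P) {n : ℕ} {f : Ω → ℝ} (hf : Measurable[past C n] f) {w : E → ℝ}
    (hw : Measurable w) : IndepFun f (fun ω => w (C n ω)) P := by
  have h := indep_iSup_of_disjoint (fun l => (hC l).comap_le) hind.iIndep
    (S := Set.Iio n) (T := {n}) (by simp)
  rw [IndepFun_iff_Indep]
  refine indep_of_indep_of_le h hf.comap_le ?_
  simp only [Set.mem_singleton_iff, iSup_iSup_eq_left]
  have h1 : Measurable[mE.comap (C n)] fun ω => w (C n ω) := hw.comp (comap_measurable _)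
  exact h1.comap_le

variable {C : ℕ → Ω → E} {ν : Measure E}

theorem memLp_comp_of_map_eq (hC : ∀ j, Measurable (C j)) (hlaw : ∀ j, P.map (C j) = ν)
    {p : ENNReal} {w : E → ℝ} (hw : MemLp w p ν) (j : ℕ) : MemLp (fun ω => w (C j ω)) p P := by
  rw [← hlaw j] at hw
  exact hw.comp_of_map (hC j).aemeasurable

theorem integral_comp_of_map_eq (hC : ∀ j, Measurable (C j)) (hlaw : ∀ j, P.map (C j) = ν)
    {w : E → ℝ} (hw : Measurable w) (j : ℕ) : ∫ ω, w (C j ω) ∂P = ∫ c, w c ∂ν := by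
  rw [← hlaw j, integral_map (hC j).aemeasurable hw.aestronglyMeasurable]

theorem ae_tendsto_sum_comp_div (hC : ∀ j, Measurable (C j)) (hind : iIndepFun C P)
    (hlaw : ∀ j, P.map (C j) = ν) {w : E → ℝ} (hw : Measurable w) (hint : Integrable w ν) :
    ∀ᵐ ω ∂P, Tendsto (fun n : ℕ => (∑ j ∈ Finset.range n, w (C j ω)) / (n : ℝ)) atTop
      (𝓝 (∫ c, w c ∂ν)) := by
  have h := strong_law_ae_real (μ := P) (fun j ω => w (C j ω))
    (memLp_one_iff_integrable.1 (memLp_comp_of_map_eq hC hlaw (memLp_one_iff_integrable.2 hint) 0))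
    (fun i j hij => (hind.indepFun hij).comp hw hw)
    (fun i => (IdentDistrib.mk (hC i).aemeasurable (hC 0).aemeasurable
      ((hlaw i).trans (hlaw 0).symm)).comp hw)
  rwa [integral_comp_of_map_eq hC hlaw hw 0] at h

/-- A strong law of large numbers, along the squares, for the martingale differences
`A j * (w (C j) - ∫ w)` with a predictable and square bounded `A`. -/
theorem ae_tendsto_sum_mul_centered [IsProbabilityMeasure ν]
    (hC : ∀ j, Measurable (C j)) (hind : iIndepFun C P)
    (hlaw : ∀ j, P.map (C j) = ν) {A : ℕ → Ω → ℝ} (hA : ∀ n, Measurable[past C n] (A n))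
    (hA2 : ∀ n, MemLp (A n) 2 P) {K : ℝ} (hK : ∀ n, ∫ ω, A n ω ^ 2 ∂P ≤ K)
    {w : E → ℝ} (hw : Measurable w) (hw2 : MemLp w 2 ν) :
    ∀ᵐ ω ∂P, Tendsto (fun n : ℕ => (∑ j ∈ Finset.range (n ^ 2),
      A j ω * (w (C j ω) - ∫ c, w c ∂ν)) / (n : ℝ) ^ 2) atTop (𝓝 0) := by
  set b := ∫ c, w c ∂ν with hb
  have hv : Measurable fun c => w c - b := hw.sub_const b
  have hv2 : MemLp (fun c => w c - b) 2 ν := hw2.sub (memLp_const b)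
  have hvC : ∀ j, MemLp (fun ω => w (C j ω) - b) 2 P := memLp_comp_of_map_eq hC hlaw hv2
  have hv0 : ∀ j, ∫ ω, (w (C j ω) - b) ∂P = 0 := fun j => by
    rw [integral_comp_of_map_eq hC hlaw hv j, integral_sub (hw2.integrable one_le_two)
      (integrable_const _)]
    simp [hb]
  -- Independence makes the product of two square integrable factors square integrable, so no fourth
  -- moments are needed.
  have hsq : ∀ j, IndepFun (fun ω => A j ω ^ 2) (fun ω => (w (C j ω) - b) ^ 2) P := fun j =>
    indepFun_of_measurable_past hC hind ((hA j).pow_const 2) (hv.pow_const 2)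
  have hU : ∀ j, MemLp (fun ω => A j ω * (w (C j ω) - b)) 2 P := fun j => by
    refine (memLp_two_iff_integrable_sq ((hA2 j).aestronglyMeasurable.mul
      (hvC j).aestronglyMeasurable)).2 ?_
    refine ((hsq j).integrable_mul (hA2 j).integrable_sq (hvC j).integrable_sq).congr
      (ae_of_all _ fun ω => ?_)
    simp [mul_pow]
  refine ae_tendsto_sum_div_of_orthogonal (K := K * ∫ c, (w c - b) ^ 2 ∂ν) hU
    (fun i j hij => ?_) (fun j => ?_)
  · have hm : Measurable[past C j] fun ω => A i ω * (w (C i ω) - b) * A j ω :=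
      (((hA i).mono (past_mono C hij.le) le_rfl).mul (measurable_past_comp hij hv)).mul (hA j)
    have h := (indepFun_of_measurable_past hC hind hm hv).integral_fun_mul_eq_mul_integral
      ((hU i).aestronglyMeasurable.mul (hA2 j).aestronglyMeasurable) (hvC j).aestronglyMeasurable
    rw [hv0 j, mul_zero] at h
    simpa only [mul_assoc] using h
  · simp_rw [mul_pow]
    rw [(hsq j).integral_fun_mul_eq_mul_integral (hA2 j).integrable_sq.aestronglyMeasurable
      (hvC j).integrable_sq.aestronglyMeasurable,
      integral_comp_of_map_eq hC hlaw (hv.pow_const 2) j]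
    exact mul_le_mul_of_nonneg_right (hK j) (integral_nonneg fun c => sq_nonneg _)

variable {y d m : E → ℝ}

theorem measurable_past_ageAtStamp (hy : Measurable y) (hd : Measurable d) (n : ℕ) :
    Measurable[past C n] fun ω => ageAtStamp (fun j => y (C j ω)) (fun j => d (C j ω)) 0 n := by
  induction n with
  | zero => exact measurable_const
  | succ n ih =>
    exact (measurable_past_comp n.lt_succ_self hy).add
      ((measurable_past_comp n.lt_succ_self (hd.const_sub 1)).mul
        (ih.mono (past_mono C n.le_succ) le_rfl))

theorem memLp_ageAtStamp [IsProbabilityMeasure P]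
    (hC : ∀ j, Measurable (C j)) (hlaw : ∀ j, P.map (C j) = ν)
    (hd : Measurable d) (hy2 : MemLp y 2 ν) (hd0 : ∀ c, 0 ≤ d c) (hd1 : ∀ c, d c ≤ 1) (n : ℕ) :
    MemLp (fun ω => ageAtStamp (fun j => y (C j ω)) (fun j => d (C j ω)) 0 n) 2 P := by
  induction n with
  | zero => exact memLp_const 0
  | succ n ih =>
    refine (memLp_comp_of_map_eq hC hlaw hy2 n).add (ih.mono ?_ (ae_of_all _ fun ω => ?_))
    · exact ((hd.comp (hC n)).const_sub 1).aestronglyMeasurable.mul ih.aestronglyMeasurable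
    · rw [norm_mul]
      refine mul_le_of_le_one_left (norm_nonneg _) ?_
      rw [Real.norm_eq_abs, abs_le]
      constructor <;> linarith [hd0 (C n ω), hd1 (C n ω)]

/-- Since `(1 - d) ^ 2 ≤ 1 - d`, one step of the recursion multiplies the second moment by at most
`(1 + q) * (1 - q) < 1`, up to an additive constant. -/
theorem exists_integral_ageAtStamp_sq_le [IsProbabilityMeasure P] [IsProbabilityMeasure ν]
    (hC : ∀ j, Measurable (C j)) (hind : iIndepFun C P)
    (hlaw : ∀ j, P.map (C j) = ν) (hy : Measurable y) (hd : Measurable d) (hy2 : MemLp y 2 ν)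
    (hd0 : ∀ c, 0 ≤ d c) (hd1 : ∀ c, d c ≤ 1) (hq : 0 < ∫ c, d c ∂ν) :
    ∃ K, ∀ n,
      ∫ ω, ageAtStamp (fun j => y (C j ω)) (fun j => d (C j ω)) 0 n ^ 2 ∂P ≤ K := by
  set q := ∫ c, d c ∂ν with hq_def
  set s := ∫ c, y c ^ 2 ∂ν with hs_def
  have hs : 0 ≤ s := integral_nonneg fun c => sq_nonneg _
  have hdi : Integrable d ν := Integrable.of_bound hd.aestronglyMeasurable 1
    (ae_of_all _ fun c => by rw [Real.norm_eq_abs, abs_of_nonneg (hd0 c)]; exact hd1 c)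
  have hrm : Measurable fun c => (1 - d c) ^ 2 := (hd.const_sub 1).pow_const 2
  have hri : Integrable (fun c => (1 - d c) ^ 2) ν := Integrable.of_bound
    hrm.aestronglyMeasurable 1 (ae_of_all _ fun c => by
      rw [Real.norm_eq_abs, abs_of_nonneg (sq_nonneg _)]
      nlinarith [hd0 c, hd1 c])
  have hr : ∫ c, (1 - d c) ^ 2 ∂ν ≤ 1 - q := by
    have : ∫ c, (1 - d c) ∂ν = 1 - q := by
      rw [integral_sub (integrable_const _) hdi]; simp [hq_def]
    rw [← this]
    refine integral_mono hri ((integrable_const _).sub hdi) fun c => ?_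
    nlinarith [hd0 c, hd1 c]
  -- The fixed point of `K ↦ (1 + q⁻¹) * s + (1 - q ^ 2) * K`.
  refine ⟨(1 + q⁻¹) * s / q ^ 2, fun n => ?_⟩
  have hA2 := fun n => memLp_ageAtStamp hC hlaw hd hy2 hd0 hd1 n
  have hAm := fun n => measurable_past_ageAtStamp (C := C) hy hd n
  set A : ℕ → Ω → ℝ := fun n ω => ageAtStamp (fun j => y (C j ω)) (fun j => d (C j ω)) 0 n with hA
  change ∫ ω, A n ω ^ 2 ∂P ≤ _
  induction n with
  | zero =>
    have : ∫ ω, A 0 ω ^ 2 ∂P = 0 := by simp [hA, ageAtStamp]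
    rw [this]; positivity
  | succ n ih =>
    have hI := indepFun_of_measurable_past hC hind ((hAm n).pow_const 2) hrm
    have hyn := memLp_comp_of_map_eq hC hlaw hy2 n
    have hrn : Integrable (fun ω => (1 - d (C n ω)) ^ 2) P :=
      memLp_one_iff_integrable.1
        (memLp_comp_of_map_eq hC hlaw (memLp_one_iff_integrable.2 hri) n)
    have hprod : Integrable (fun ω => A n ω ^ 2 * (1 - d (C n ω)) ^ 2) P :=
      hI.integrable_mul (hA2 n).integrable_sq hrn
    have hle : ∀ ω, A (n + 1) ω ^ 2 ≤
        (1 + q⁻¹) * y (C n ω) ^ 2 + (1 + q) * (A n ω ^ 2 * (1 - d (C n ω)) ^ 2) := fun ω => by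
      change (y (C n ω) + (1 - d (C n ω)) * A n ω) ^ 2 ≤ _
      have h0 : 0 ≤ q⁻¹ * (y (C n ω) - q * ((1 - d (C n ω)) * A n ω)) ^ 2 := by positivity
      have h1 : q⁻¹ * (y (C n ω) - q * ((1 - d (C n ω)) * A n ω)) ^ 2 =
          q⁻¹ * y (C n ω) ^ 2 - 2 * y (C n ω) * ((1 - d (C n ω)) * A n ω)
            + q * (A n ω ^ 2 * (1 - d (C n ω)) ^ 2) := by
        field_simp
        ring
      nlinarith
    have h1 : ∫ ω, A (n + 1) ω ^ 2 ∂P ≤ (1 + q⁻¹) * s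
        + (1 + q) * ((∫ ω, A n ω ^ 2 ∂P) * ∫ c, (1 - d c) ^ 2 ∂ν) := by
      have hi : Integrable (fun ω => (1 + q⁻¹) * y (C n ω) ^ 2 +
          (1 + q) * (A n ω ^ 2 * (1 - d (C n ω)) ^ 2)) P :=
        (hyn.integrable_sq.const_mul _).add (hprod.const_mul _)
      refine (integral_mono (hA2 (n + 1)).integrable_sq hi hle).trans_eq ?_
      rw [integral_add (hyn.integrable_sq.const_mul _) (hprod.const_mul _), integral_const_mul,
        integral_const_mul, hI.integral_fun_mul_eq_mul_integral
          (hA2 n).integrable_sq.aestronglyMeasurable hrn.aestronglyMeasurable,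
        integral_comp_of_map_eq hC hlaw (hy.pow_const 2) n,
        integral_comp_of_map_eq hC hlaw hrm n]
    have hAn : 0 ≤ ∫ ω, A n ω ^ 2 ∂P := integral_nonneg fun ω => sq_nonneg _
    have hq1 : q ≤ 1 := by
      have : 0 ≤ ∫ c, (1 - d c) ^ 2 ∂ν := integral_nonneg fun c => sq_nonneg _
      linarith
    calc ∫ ω, A (n + 1) ω ^ 2 ∂P
        ≤ (1 + q⁻¹) * s + (1 + q) * (((1 + q⁻¹) * s / q ^ 2) * (1 - q)) := by
          refine h1.trans ?_
          gcongr
      _ = (1 + q⁻¹) * s / q ^ 2 := by field_simp; ring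

/-- The recursion reads `A j * d j = y j + A j - A (j + 1)`, which telescopes. -/
theorem sum_ageAtStamp_mul (y d : ℕ → ℝ) (n : ℕ) :
    ∑ j ∈ Finset.range n, ageAtStamp y d 0 j * d j =
      ∑ j ∈ Finset.range n, y j - ageAtStamp y d 0 n := by
  induction n with
  | zero => simp [ageAtStamp]
  | succ n ih =>
    rw [Finset.sum_range_succ, Finset.sum_range_succ, ih, ageAtStamp]; ring

theorem ae_tendsto_sum_ageAtStamp_mul [IsProbabilityMeasure P] [IsProbabilityMeasure ν]
    (hC : ∀ j, Measurable (C j)) (hind : iIndepFun C P)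
    (hlaw : ∀ j, P.map (C j) = ν) (hy : Measurable y) (hd : Measurable d) (hm : Measurable m)
    (hy2 : MemLp y 2 ν) (hm2 : MemLp m 2 ν) (hd0 : ∀ c, 0 ≤ d c) (hd1 : ∀ c, d c ≤ 1)
    (hq : 0 < ∫ c, d c ∂ν) :
    ∀ᵐ ω ∂P, Tendsto (fun n : ℕ => (∑ j ∈ Finset.range (n ^ 2),
      ageAtStamp (fun j => y (C j ω)) (fun j => d (C j ω)) 0 j * m (C j ω)) / (n : ℝ) ^ 2) atTop
      (𝓝 ((∫ c, m c ∂ν) * ((∫ c, y c ∂ν) / ∫ c, d c ∂ν))) := by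
  have hA2 := fun n => memLp_ageAtStamp (P := P) hC hlaw hd hy2 hd0 hd1 n
  have hAm := fun n => measurable_past_ageAtStamp (C := C) hy hd n
  obtain ⟨K, hK⟩ := exists_integral_ageAtStamp_sq_le hC hind hlaw hy hd hy2 hd0 hd1 hq
  have hd2 : MemLp d 2 ν := MemLp.of_bound hd.aestronglyMeasurable 1
    (ae_of_all _ fun c => by rw [Real.norm_eq_abs, abs_of_nonneg (hd0 c)]; exact hd1 c)
  have hsq : Tendsto (fun n : ℕ => n ^ 2) atTop atTop := tendsto_pow_atTop two_ne_zero
  have hend : ∀ᵐ ω ∂P, Tendsto (fun n : ℕ =>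
      ageAtStamp (fun j => y (C j ω)) (fun j => d (C j ω)) 0 (n ^ 2) / (n : ℝ) ^ 2) atTop
        (𝓝 0) := by
    refine ae_tendsto_zero_of_summable_integral_sq (fun n => ?_) ?_
    · simpa only [div_eq_mul_inv] using (hA2 (n ^ 2)).mul_const _
    · refine Summable.of_nonneg_of_le (fun n => integral_nonneg fun ω => sq_nonneg _)
        (fun n => ?_) ((Real.summable_one_div_nat_pow.2 (by norm_num : 1 < 4)).mul_left K)
      simp_rw [div_pow, ← pow_mul]
      rw [integral_div, div_eq_mul_one_div]
      exact mul_le_mul_of_nonneg_right (hK _) (by positivity)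
  filter_upwards [ae_tendsto_sum_comp_div hC hind hlaw hy (hy2.integrable one_le_two), hend,
    ae_tendsto_sum_mul_centered hC hind hlaw hAm hA2 hK hd hd2,
    ae_tendsto_sum_mul_centered hC hind hlaw hAm hA2 hK hm hm2] with ω h1 h2 h3 h4
  have h1' := h1.comp hsq
  simp only [Function.comp_def, Nat.cast_pow] at h1'
  set q := ∫ c, d c ∂ν
  set b := ∫ c, m c ∂ν
  -- The telescoped identity gives the average of `A j * d j`; centering `d` at `q` turns it into
  -- `q` times the average of `A j`.
  have h5 : Tendsto (fun n : ℕ => (∑ j ∈ Finset.range (n ^ 2),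
      ageAtStamp (fun j => y (C j ω)) (fun j => d (C j ω)) 0 j) / (n : ℝ) ^ 2) atTop
      (𝓝 ((∫ c, y c ∂ν) / q)) := by
    have h := ((h1'.sub h2).sub h3).div_const q
    simp only [sub_zero] at h
    refine h.congr fun n => ?_
    simp_rw [mul_sub]
    rw [Finset.sum_sub_distrib, ← Finset.sum_mul, sum_ageAtStamp_mul]
    field_simp
    ring
  have h := (h5.const_mul b).add h4
  rw [add_zero] at h
  refine h.congr fun n => ?_
  simp_rw [mul_sub]
  rw [Finset.sum_sub_distrib, ← Finset.sum_mul]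
  ring

end IID

/-! ### The age along one sample path -/

theorem ageAtStamp_nonneg {y d : ℕ → ℝ} {a : ℝ} (hy : ∀ j, 0 ≤ y j) (hd : ∀ j, d j ≤ 1)
    (ha : 0 ≤ a) (n : ℕ) : 0 ≤ ageAtStamp y d a n := by
  induction n with
  | zero => exact ha
  | succ n ih => exact add_nonneg (hy n) (mul_nonneg (sub_nonneg.2 (hd n)) ih)

/-- Isolates the influence of the initial age, which disappears at the first delivery; the
probabilistic part can then start from age `0`. -/
theorem ageAtStamp_eq_add (y d : ℕ → ℝ) (a : ℝ) (n : ℕ) :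
    ageAtStamp y d a n = ageAtStamp y d 0 n + a * ∏ j ∈ Finset.range n, (1 - d j) := by
  induction n with
  | zero => simp [ageAtStamp]
  | succ n ih => rw [ageAtStamp, ageAtStamp, ih, Finset.prod_range_succ]; ring

/-- `1` if update `j` reaches node `i`, and `0` if not. -/
noncomputable def deliveryIndicator {n : ℕ} (k : ℕ) (x : Fin n → ℕ → ℝ) (i : Fin n) (j : ℕ) : ℝ :=
  if x i j ≤ serviceInterval k x j then 1 else 0

section Path

variable {n k : ℕ} {x : Fin n → ℕ → ℝ} {i : Fin n} {a : ℝ}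

theorem deliveryIndicator_le_one (j : ℕ) : deliveryIndicator k x i j ≤ 1 := by
  unfold deliveryIndicator; split_ifs <;> norm_num

theorem serviceInterval_nonneg (hx : ∀ i j, 0 ≤ x i j) (j : ℕ) : 0 ≤ serviceInterval k x j :=
  Real.iSup_nonneg fun r => hx r.1 j

theorem stamp_succ (j : ℕ) : stamp k x (j + 1) = stamp k x j + serviceInterval k x j :=
  Finset.sum_range_succ _ _

theorem stamp_mono (hx : ∀ i j, 0 ≤ x i j) : Monotone (stamp k x) :=
  monotone_nat_of_le_succ fun j => by
    rw [stamp_succ]; linarith [serviceInterval_nonneg (k := k) hx j]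

/-- Ties the recursion to the model: `stamp - ageAtStamp` is the freshest stamp held when update `j`
is generated. -/
theorem isGreatest_stamp_sub_ageAtStamp (hx : ∀ i j, 0 ≤ x i j) (ha : 0 ≤ a) (j : ℕ) :
    IsGreatest (insert (-a) {s | ∃ l < j, Delivered k x i l ∧ s = stamp k x l})
      (stamp k x j - ageAtStamp (serviceInterval k x) (deliveryIndicator k x i) a j) := by
  induction j with
  | zero => simp [stamp, ageAtStamp]
  | succ j ih =>
    have hA := ageAtStamp_nonneg (y := serviceInterval k x) (d := deliveryIndicator k x i)
      (serviceInterval_nonneg hx) deliveryIndicator_le_one ha j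
    rw [stamp_succ, ageAtStamp]
    by_cases h : x i j ≤ serviceInterval k x j
    · have h1 : deliveryIndicator k x i j = 1 := if_pos h
      have hval : stamp k x j + serviceInterval k x j - (serviceInterval k x j + (1 - 1) *
          ageAtStamp (serviceInterval k x) (deliveryIndicator k x i) a j) = stamp k x j := by ring
      rw [h1, hval]
      refine ⟨Or.inr ⟨j, j.lt_succ_self, h, rfl⟩, ?_⟩
      rintro s (rfl | ⟨l, hl, hd, rfl⟩)
      · linarith [ih.2 (Set.mem_insert _ _)]
      · exact stamp_mono hx (Nat.lt_succ_iff.1 hl)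
    · have h0 : deliveryIndicator k x i j = 0 := if_neg h
      have hset : {s | ∃ l < j + 1, Delivered k x i l ∧ s = stamp k x l} =
          {s | ∃ l < j, Delivered k x i l ∧ s = stamp k x l} := by
        ext s
        constructor
        · rintro ⟨l, hl, hd, rfl⟩
          refine ⟨l, lt_of_le_of_ne (Nat.lt_succ_iff.1 hl) ?_, hd, rfl⟩
          rintro rfl
          exact h hd
        · rintro ⟨l, hl, hd, rfl⟩
          exact ⟨l, hl.trans j.lt_succ_self, hd, rfl⟩
      rw [h0, hset]
      convert ih using 1
      ring

/-- During cycle `j` all earlier deliveries have arrived and no later update exists, so only the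
arrival of update `j` matters. If it is terminated, the minimum is the service interval and the
threshold lies at the end of the cycle. -/
theorem age_eq (hx : ∀ i j, 0 ≤ x i j) (ha : 0 ≤ a) {j : ℕ} {t : ℝ} (ht : stamp k x j ≤ t)
    (ht' : t < stamp k x (j + 1)) :
    age k x a i t = (t - stamp k x j) +
      if t < stamp k x j + min (x i j) (serviceInterval k x j) then
        ageAtStamp (serviceInterval k x) (deliveryIndicator k x i) a j else 0 := by
  have hA := ageAtStamp_nonneg (y := serviceInterval k x) (d := deliveryIndicator k x i)
    (serviceInterval_nonneg hx) deliveryIndicator_le_one ha j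
  have hg := isGreatest_stamp_sub_ageAtStamp (k := k) (i := i) hx ha j
  have hlt : ∀ {l}, stamp k x l + x i l ≤ t → l ≤ j := fun {l} hl => by
    by_contra! hjl
    linarith [stamp_mono (k := k) hx (Nat.succ_le_of_lt hjl), hx i l]
  have hpast : ∀ {l}, l < j → Delivered k x i l → stamp k x l + x i l ≤ t := fun {l} hl hd => by
    have h1 := stamp_mono (k := k) hx (Nat.succ_le_of_lt hl)
    have h2 : x i l ≤ serviceInterval k x l := hd
    rw [Nat.succ_eq_add_one, stamp_succ] at h1
    linarith
  rw [stamp_succ] at ht'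
  split_ifs with h
  · suffices IsGreatest (insert (-a)
        {s | ∃ j : ℕ, Delivered k x i j ∧ stamp k x j + x i j ≤ t ∧ s = stamp k x j})
        (stamp k x j - ageAtStamp (serviceInterval k x) (deliveryIndicator k x i) a j) by
      rw [age, lastStamp, this.csSup_eq]; ring
    convert hg using 2
    ext s
    constructor
    · rintro ⟨l, hd, hl, rfl⟩
      refine ⟨l, lt_of_le_of_ne (hlt hl) ?_, hd, rfl⟩
      rintro rfl
      rw [min_eq_left hd] at h
      linarith
    · rintro ⟨l, hl, hd, rfl⟩
      exact ⟨l, hd, hpast hl hd, rfl⟩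
  · have hd : x i j ≤ serviceInterval k x j := by
      by_contra! hc
      rw [min_eq_right hc.le] at h
      exact h ht'
    rw [min_eq_left hd] at h
    suffices IsGreatest (insert (-a)
        {s | ∃ j : ℕ, Delivered k x i j ∧ stamp k x j + x i j ≤ t ∧ s = stamp k x j})
        (stamp k x j) by
      rw [age, lastStamp, this.csSup_eq]; ring
    refine ⟨Or.inr ⟨j, hd, not_lt.1 h, rfl⟩, ?_⟩
    rintro s (rfl | ⟨l, -, hl, rfl⟩)
    · linarith [hg.2 (Set.mem_insert _ _)]
    · exact stamp_mono hx (hlt hl)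

theorem age_nonneg (hx : ∀ i j, 0 ≤ x i j) (ha : 0 ≤ a) {t : ℝ} (ht : 0 ≤ t) :
    0 ≤ age k x a i t := by
  refine sub_nonneg.2 (csSup_le (Set.insert_nonempty _ _) ?_)
  rintro s (rfl | ⟨l, -, hl, rfl⟩)
  · linarith
  · linarith [hx i l]

theorem hasIntegral_age_cycle (hx : ∀ i j, 0 ≤ x i j) (ha : 0 ≤ a) (j : ℕ) :
    IntervalIntegrable (age k x a i) volume (stamp k x j) (stamp k x (j + 1)) ∧
    ∫ t in stamp k x j..stamp k x (j + 1), age k x a i t = serviceInterval k x j ^ 2 / 2 +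
      ageAtStamp (serviceInterval k x) (deliveryIndicator k x i) a j *
        min (x i j) (serviceInterval k x j) := by
  set A := ageAtStamp (serviceInterval k x) (deliveryIndicator k x i) a j
  set m := min (x i j) (serviceInterval k x j) with hm
  set T := stamp k x j with hT
  have hY := serviceInterval_nonneg (k := k) hx j
  have hm0 : 0 ≤ m := le_min (hx i j) hY
  have hmY : m ≤ serviceInterval k x j := min_le_right _ _
  have hs := stamp_succ (k := k) (x := x) j
  rw [← hT] at hs
  have hle1 : T ≤ T + m := by linarith
  have hle2 : T + m ≤ stamp k x (j + 1) := by linarith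
  have e1 : Set.EqOn (age k x a i) (fun t => (t - T) + A) (Set.Ioo T (T + m)) := fun t ht => by
    rw [age_eq hx ha ht.1.le (ht.2.trans_le hle2), if_pos ht.2]
  have e2 : Set.EqOn (age k x a i) (fun t => t - T) (Set.Ioo (T + m) (stamp k x (j + 1))) :=
    fun t ht => by
    rw [age_eq hx ha (hle1.trans ht.1.le) ht.2, if_neg (not_lt.2 ht.1.le), add_zero]
  have i1 : IntervalIntegrable (age k x a i) volume T (T + m) := by
    have : IntervalIntegrable (fun t => (t - T) + A) volume T (T + m) :=
      Continuous.intervalIntegrable (by fun_prop) _ _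
    refine this.congr_uIoo ?_
    rw [Set.uIoo_of_le hle1]
    exact e1.symm
  have i2 : IntervalIntegrable (age k x a i) volume (T + m) (stamp k x (j + 1)) := by
    have : IntervalIntegrable (fun t => t - T) volume (T + m) (stamp k x (j + 1)) :=
      Continuous.intervalIntegrable (by fun_prop) _ _
    refine this.congr_uIoo ?_
    rw [Set.uIoo_of_le hle2]
    exact e2.symm
  refine ⟨i1.trans i2, ?_⟩
  rw [← intervalIntegral.integral_add_adjacent_intervals i1 i2,
    intervalIntegral.integral_congr_Ioo_of_le hle1 e1,
    intervalIntegral.integral_congr_Ioo_of_le hle2 e2,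
    intervalIntegral.integral_add (Continuous.intervalIntegrable (by fun_prop) _ _)
      (Continuous.intervalIntegrable (by fun_prop) _ _),
    intervalIntegral.integral_comp_sub_right (fun t => t),
    intervalIntegral.integral_comp_sub_right (fun t => t), integral_id, integral_id,
    intervalIntegral.integral_const, hs, smul_eq_mul]
  ring

theorem hasIntegral_age_stamp (hx : ∀ i j, 0 ≤ x i j) (ha : 0 ≤ a) (N : ℕ) :
    IntervalIntegrable (age k x a i) volume 0 (stamp k x N) ∧
    ∫ t in (0 : ℝ)..stamp k x N, age k x a i t =
      (∑ j ∈ Finset.range N, serviceInterval k x j ^ 2) / 2 + ∑ j ∈ Finset.range N,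
        ageAtStamp (serviceInterval k x) (deliveryIndicator k x i) a j *
          min (x i j) (serviceInterval k x j) := by
  induction N with
  | zero => simp [stamp]
  | succ N ih =>
    obtain ⟨h1, h2⟩ := hasIntegral_age_cycle (k := k) (i := i) hx ha N
    refine ⟨ih.1.trans h1, ?_⟩
    rw [← intervalIntegral.integral_add_adjacent_intervals ih.1 h1, ih.2, h2,
      Finset.sum_range_succ, Finset.sum_range_succ]
    ring

theorem intervalIntegrable_age (hx : ∀ i j, 0 ≤ x i j) (ha : 0 ≤ a)
    (hT : Tendsto (stamp k x) atTop atTop) {τ : ℝ} (hτ : 0 ≤ τ) :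
    IntervalIntegrable (age k x a i) volume 0 τ := by
  obtain ⟨N, hN⟩ := (hT.eventually_ge_atTop τ).exists
  refine (hasIntegral_age_stamp hx ha N).1.mono_set ?_
  rw [Set.uIcc_of_le hτ, Set.uIcc_of_le (hτ.trans hN)]
  exact Set.Icc_subset_Icc_right hN

end Path

/-! ### From averages over updates to the time average -/

/-- If the time average of a nonnegative function converges along times `s n` with
`s (n + 1) / s n → 1`, then it converges. -/
theorem tendsto_average_of_tendsto_subseq {f : ℝ → ℝ} (hf : ∀ t, 0 ≤ t → 0 ≤ f t)
    (hint : ∀ τ, 0 ≤ τ → IntervalIntegrable f volume 0 τ) {s : ℕ → ℝ}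
    (hs : Tendsto s atTop atTop) (hratio : Tendsto (fun n => s (n + 1) / s n) atTop (𝓝 1))
    {L : ℝ} (hL : Tendsto (fun n => (∫ t in (0 : ℝ)..s n, f t) / s n) atTop (𝓝 L)) :
    Tendsto (fun τ => 1 / τ * ∫ t in (0 : ℝ)..τ, f t) atTop (𝓝 L) := by
  have hmono : ∀ {u v : ℝ}, 0 ≤ u → u ≤ v → ∫ t in (0 : ℝ)..u, f t ≤ ∫ t in (0 : ℝ)..v, f t :=
    fun {u v} hu huv => intervalIntegral.integral_mono_interval le_rfl hu huv
      (by
        filter_upwards [ae_restrict_mem measurableSet_Ioc] with t ht using hf t ht.1.le)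
      (hint v (hu.trans huv))
  have hnn : ∀ {u : ℝ}, 0 ≤ u → 0 ≤ ∫ t in (0 : ℝ)..u, f t := fun {u} hu =>
    intervalIntegral.integral_nonneg hu fun t ht => hf t ht.1
  have hex : ∀ τ, ∃ n, τ < s (n + 1) := fun τ =>
    (((tendsto_add_atTop_iff_nat 1).2 hs).eventually_gt_atTop τ).exists
  classical
  let N : ℝ → ℕ := fun τ => Nat.find (hex τ)
  have hN1 : ∀ τ, τ < s (N τ + 1) := fun τ => Nat.find_spec (hex τ)
  have hN2 : ∀ τ, s 0 ≤ τ → s (N τ) ≤ τ := fun τ h0 => by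
    rcases hc : N τ with _ | m
    · exact h0
    · exact not_lt.1 (Nat.find_min (hex τ) (m := m) (by change m < N τ; omega))
  have hN : Tendsto N atTop atTop := by
    refine tendsto_atTop.2 fun K => ?_
    -- `s` need not be monotone, so the sum of absolute values serves as a bound for its first `K +
    -- 1` terms.
    filter_upwards [eventually_ge_atTop (∑ l ∈ Finset.range (K + 1), |s l|)] with τ hτ
    by_contra! hc
    have h1 : |s (N τ + 1)| ≤ ∑ l ∈ Finset.range (K + 1), |s l| :=
      Finset.single_le_sum (f := fun l => |s l|) (fun l _ => abs_nonneg _)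
        (Finset.mem_range.2 (by omega))
    linarith [hN1 τ, le_abs_self (s (N τ + 1))]
  have hpos : ∀ᶠ n in atTop, 0 < s n ∧ 0 < s (n + 1) :=
    (hs.eventually_gt_atTop 0).and
      (((tendsto_add_atTop_iff_nat 1).2 hs).eventually_gt_atTop 0)
  have hlow : Tendsto (fun n => (∫ t in (0 : ℝ)..s n, f t) / s (n + 1)) atTop (𝓝 L) := by
    have h := hL.div hratio one_ne_zero
    rw [div_one] at h
    refine h.congr' ?_
    filter_upwards [hpos] with n hn
    have := hn.1.ne'
    have := hn.2.ne'
    simp only [Pi.div_apply]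
    field_simp
  have hup : Tendsto (fun n => (∫ t in (0 : ℝ)..s (n + 1), f t) / s n) atTop (𝓝 L) := by
    have h := ((tendsto_add_atTop_iff_nat 1).2 hL).mul hratio
    rw [mul_one] at h
    refine h.congr' ?_
    filter_upwards [hpos] with n hn
    have := hn.1.ne'
    have := hn.2.ne'
    field_simp
  refine tendsto_of_tendsto_of_tendsto_of_le_of_le' (hlow.comp hN) (hup.comp hN) ?_ ?_
  · filter_upwards [hN.eventually hpos, eventually_ge_atTop (s 0), eventually_gt_atTop 0]
      with τ hp h0 hτ
    rw [one_div, inv_mul_eq_div]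
    exact div_le_div₀ (hnn hτ.le) (hmono hp.1.le (hN2 τ h0)) hτ (hN1 τ).le
  · filter_upwards [hN.eventually hpos, eventually_ge_atTop (s 0), eventually_gt_atTop 0]
      with τ hp h0 hτ
    rw [one_div, inv_mul_eq_div]
    exact div_le_div₀ (hnn hp.2.le) (hmono hτ.le (hN1 τ).le) hp.1 (hN2 τ h0)

/-- The average age along one sample path, from the averages over the updates. -/
theorem tendsto_average_age {n k : ℕ} {x : Fin n → ℕ → ℝ} {i : Fin n} {a : ℝ}
    (hx : ∀ i j, 0 ≤ x i j) (ha : 0 ≤ a) {m₁ m₂ b q : ℝ} (hm₁ : 0 < m₁) (hq : 0 < q)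
    (h₁ : Tendsto (fun N : ℕ => (∑ j ∈ Finset.range N, serviceInterval k x j) / (N : ℝ)) atTop
      (𝓝 m₁))
    (h₂ : Tendsto (fun N : ℕ => (∑ j ∈ Finset.range N, serviceInterval k x j ^ 2) / (N : ℝ)) atTop
      (𝓝 m₂))
    (hd : Tendsto (fun N : ℕ => (∑ j ∈ Finset.range N, deliveryIndicator k x i j) / (N : ℝ)) atTop
      (𝓝 q))
    (hA : Tendsto (fun N : ℕ => (∑ j ∈ Finset.range (N ^ 2),
      ageAtStamp (serviceInterval k x) (deliveryIndicator k x i) 0 j *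
        min (x i j) (serviceInterval k x j)) / (N : ℝ) ^ 2) atTop (𝓝 b)) :
    (∀ τ, 0 ≤ τ → IntervalIntegrable (age k x a i) volume 0 τ) ∧
    Tendsto (fun τ => 1 / τ * ∫ t in (0 : ℝ)..τ, age k x a i t) atTop
      (𝓝 ((m₂ / 2 + b) / m₁)) := by
  have hsq : Tendsto (fun n : ℕ => n ^ 2) atTop atTop := tendsto_pow_atTop two_ne_zero
  have hcast : Tendsto (fun n : ℕ => (n : ℝ)) atTop atTop := tendsto_natCast_atTop_atTop
  have hcast2 : Tendsto (fun n : ℕ => (n : ℝ) ^ 2) atTop atTop :=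
    (tendsto_pow_atTop two_ne_zero).comp hcast
  have hT : Tendsto (stamp k x) atTop atTop := by
    refine (h₁.pos_mul_atTop hm₁ hcast).congr' ?_
    filter_upwards [eventually_gt_atTop 0] with N hN
    have : (N : ℝ) ≠ 0 := by exact_mod_cast hN.ne'
    rw [div_mul_cancel₀ _ this, stamp]
  have hTsq : Tendsto (fun N : ℕ => stamp k x (N ^ 2) / (N : ℝ) ^ 2) atTop (𝓝 m₁) := by
    have h := h₁.comp hsq
    simpa only [Function.comp_def, Nat.cast_pow, stamp] using h
  have hint := fun τ (hτ : 0 ≤ τ) => intervalIntegrable_age (i := i) hx ha hT hτ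
  refine ⟨hint, tendsto_average_of_tendsto_subseq (s := fun N => stamp k x (N ^ 2))
    (fun t ht => age_nonneg hx ha ht) hint (hT.comp hsq) ?_ ?_⟩
  · have hone : Tendsto (fun N : ℕ => (((N : ℝ) + 1) / N) ^ 2) atTop (𝓝 1) := by
      have : Tendsto (fun N : ℕ => 1 + 1 / (N : ℝ)) atTop (𝓝 (1 + 0)) :=
        tendsto_one_div_atTop_nhds_zero_nat.const_add 1
      have h := (this.pow 2).congr' (f₂ := fun N : ℕ => (((N : ℝ) + 1) / N) ^ 2) (by
        filter_upwards [eventually_gt_atTop 0] with N hN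
        have : (N : ℝ) ≠ 0 := by exact_mod_cast hN.ne'
        rw [add_div, div_self this])
      simpa using h
    have h := (((tendsto_add_atTop_iff_nat 1).2 hTsq).div hTsq hm₁.ne').mul hone
    rw [div_self hm₁.ne', one_mul] at h
    refine h.congr' ?_
    filter_upwards [eventually_gt_atTop 0, (hT.comp hsq).eventually_gt_atTop 0] with N hN hpos
    have h1 : (N : ℝ) ≠ 0 := by exact_mod_cast hN.ne'
    have h2 : (N : ℝ) + 1 ≠ 0 := by positivity
    have h3 : stamp k x (N ^ 2) ≠ 0 := ne_of_gt hpos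
    simp only [Pi.div_apply]
    push_cast
    field_simp
  -- A positive delivery frequency forces some delivery, after which the initial age contributes
  -- nothing; its total contribution `c` is a finite sum.
  · have hdel : ∃ J, deliveryIndicator k x i J = 1 := by
      by_contra! hc
      have h0 : ∀ j, deliveryIndicator k x i j = 0 := fun j => by
        have := hc j
        unfold deliveryIndicator at this ⊢
        split_ifs at this ⊢ <;> simp_all
      simp only [h0, Finset.sum_const_zero, zero_div] at hd
      exact hq.ne (tendsto_nhds_unique tendsto_const_nhds hd)
    obtain ⟨J, hJ⟩ := hdel
    set c : ℕ → ℝ := fun j => (a * ∏ l ∈ Finset.range j, (1 - deliveryIndicator k x i l)) *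
      min (x i j) (serviceInterval k x j) with hc
    have hc0 : ∀ j, J < j → c j = 0 := fun j hj => by
      have : ∏ l ∈ Finset.range j, (1 - deliveryIndicator k x i l) = 0 :=
        Finset.prod_eq_zero (Finset.mem_range.2 hj) (by rw [hJ, sub_self])
      simp [hc, this]
    have hcsum : Tendsto (fun N : ℕ => (∑ j ∈ Finset.range (N ^ 2), c j) / (N : ℝ) ^ 2) atTop
        (𝓝 0) := by
      refine (Tendsto.const_div_atTop hcast2 (∑ j ∈ Finset.range (J + 1), c j)).congr' ?_
      filter_upwards [hsq.eventually_ge_atTop (J + 1)] with N hN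
      congr 1
      refine Finset.sum_subset (Finset.range_mono hN) fun j _ hj => hc0 j ?_
      rw [Finset.mem_range] at hj
      omega
    have h2 : Tendsto (fun N : ℕ => (∑ j ∈ Finset.range (N ^ 2), serviceInterval k x j ^ 2) /
        (N : ℝ) ^ 2) atTop (𝓝 m₂) := by
      have h := h₂.comp hsq
      simpa only [Function.comp_def, Nat.cast_pow] using h
    have h := (((h2.div_const 2).add hA).add hcsum).div hTsq hm₁.ne'
    rw [add_zero] at h
    refine h.congr' ?_
    filter_upwards [eventually_gt_atTop 0, (hT.comp hsq).eventually_gt_atTop 0] with N hN hpos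
    have h1 : (N : ℝ) ≠ 0 := by exact_mod_cast hN.ne'
    have h3 : stamp k x (N ^ 2) ≠ 0 := ne_of_gt hpos
    have hsum : ∑ j ∈ Finset.range (N ^ 2), ageAtStamp (serviceInterval k x)
          (deliveryIndicator k x i) a j * min (x i j) (serviceInterval k x j) =
        ∑ j ∈ Finset.range (N ^ 2), ageAtStamp (serviceInterval k x)
          (deliveryIndicator k x i) 0 j * min (x i j) (serviceInterval k x j) +
        ∑ j ∈ Finset.range (N ^ 2), c j := by
      rw [← Finset.sum_add_distrib]
      refine Finset.sum_congr rfl fun j _ => ?_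
      rw [ageAtStamp_eq_add, hc]; ring
    rw [(hasIntegral_age_stamp hx ha _).2, hsum]
    simp only [Pi.div_apply]
    field_simp
    ring

/-! ### Independence and common law of the updates -/

section Columns

variable {Ω ι : Type*} {mΩ : MeasurableSpace Ω} [Fintype ι] {P : Measure Ω}
  {μ : Measure ℝ} {Z : ι → ℕ → Ω → ℝ}

theorem map_column_eq_pi (hZ : ∀ r j, Measurable (Z r j)) (hlaw : ∀ r j, P.map (Z r j) = μ)
    (hind : iIndepFun (fun p : ℕ × ι => Z p.2 p.1) P) (j : ℕ) :
    P.map (fun ω r => Z r j ω) = Measure.pi fun _ => μ := by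
  have h := hind.precomp (g := fun r : ι => (j, r)) fun r s h => (Prod.mk.inj h).2
  have h' := h.map_fun_eq_pi_map fun r => (hZ r j).aemeasurable
  simpa only [hlaw] using h'

/-- The joint law of the array is an infinite product measure, and currying makes it a product over
updates of products over nodes. -/
theorem iIndepFun_column [IsProbabilityMeasure P] [IsProbabilityMeasure μ]
    (hZ : ∀ r j, Measurable (Z r j)) (hlaw : ∀ r j, P.map (Z r j) = μ)
    (hind : iIndepFun (fun p : ℕ × ι => Z p.2 p.1) P) :
    iIndepFun (fun j ω r => Z r j ω) P := by
  rw [iIndepFun_iff_map_fun_eq_infinitePi_map fun j => measurable_pi_lambda _ fun r => hZ r j]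
  simp_rw [map_column_eq_pi hZ hlaw hind, ← Measure.infinitePi_eq_pi]
  have h := hind.map_fun_eq_infinitePi_map fun p : ℕ × ι => hZ p.2 p.1
  simp only [hlaw] at h
  rw [← Measure.infinitePi_map_curry (fun (_ : ℕ) (_ : ι) => μ), ← h,
    Measure.map_map (MeasurableEquiv.measurable _)
      (measurable_pi_lambda _ fun p : ℕ × ι => hZ p.2 p.1)]
  rfl

end Columns

/-! ### Reduction to the priority nodes and one further node -/

section Nodes

variable {n k : ℕ}

/-- The priority nodes, followed by the node `i`. -/
def priorityThen (i : Fin n) (hi : k ≤ (i : ℕ)) : Fin (k + 1) → Fin n :=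
  Fin.lastCases i fun r => ⟨r, r.2.trans_le (hi.trans i.2.le)⟩

variable {i : Fin n} {hi : k ≤ (i : ℕ)}

theorem priorityThen_last : priorityThen i hi (Fin.last k) = i :=
  Fin.lastCases_last

theorem priorityThen_castSucc (r : Fin k) :
    priorityThen i hi r.castSucc = ⟨r, r.2.trans_le (hi.trans i.2.le)⟩ :=
  Fin.lastCases_castSucc r

theorem priorityThen_injective : Function.Injective (priorityThen i hi) := fun r s => by
  induction r using Fin.lastCases with
  | last =>
    induction s using Fin.lastCases with
    | last => simp
    | cast s =>
      rw [priorityThen_last, priorityThen_castSucc, Fin.ext_iff]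
      intro h
      exact absurd h (by have := s.2; simp only; omega)
  | cast r =>
    induction s using Fin.lastCases with
    | last =>
      rw [priorityThen_last, priorityThen_castSucc, Fin.ext_iff]
      intro h
      exact absurd h (by have := r.2; simp only; omega)
    | cast s =>
      rw [priorityThen_castSucc, priorityThen_castSucc, Fin.ext_iff]
      intro h
      exact congrArg Fin.castSucc (Fin.ext h)

theorem serviceInterval_eq_maxOthers (x : Fin n → ℕ → ℝ) (j : ℕ) :
    serviceInterval k x j = maxOthers (Fin.last k) fun r => x (priorityThen i hi r) j := by
  let e : Fin k ≃ {i : Fin n // (i : ℕ) < k} :=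
    { toFun := fun r => ⟨⟨r, r.2.trans_le (hi.trans i.2.le)⟩, r.2⟩
      invFun := fun s => ⟨s.1, s.2⟩
      left_inv := fun _ => rfl
      right_inv := fun _ => rfl }
  rw [serviceInterval, maxOthers, ← e.iSup_comp]
  simp only [Fin.succAbove_last, priorityThen_castSucc]
  rfl

end Nodes

end Multicast

/-! ### The main theorem -/

theorem theorem2 {Ω : Type*} [MeasurableSpace Ω] (P : Measure Ω) [IsProbabilityMeasure P]
    -- the law of a service time: nonnegative, continuous, with finite second moment
    (μ : Measure ℝ) [IsProbabilityMeasure μ] [NullSingletonClass μ]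
    (hμ_nonneg : ∀ᵐ s ∂μ, 0 ≤ s) (hμ_sq : MemLp id 2 μ)
    -- `n` nodes, of which the first `k ≥ 1` have priority
    (n k : ℕ) (hk : 1 ≤ k)
    -- i.i.d. service times, `X i j` for node `i` and update `j`
    (X : Fin n → ℕ → Ω → ℝ) (hX_law : ∀ i j, HasLaw (X i j) μ P)
    (hX_indep : iIndepFun (fun p : Fin n × ℕ => X p.1 p.2) P)
    -- a non-priority node, and its age at time `0`
    (i : Fin n) (hi : k ≤ (i : ℕ)) (a : Ω → ℝ) (ha : ∀ ω, 0 ≤ a ω) :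
    ∀ᵐ ω ∂P,
      (∀ τ : ℝ, 0 ≤ τ → IntervalIntegrable
        (fun t => Multicast.age k (fun i j => X i j ω) (a ω) i t) volume 0 τ) ∧
      Tendsto
        (fun τ : ℝ =>
          1 / τ * ∫ t in (0 : ℝ)..τ, Multicast.age k (fun i j => X i j ω) (a ω) i t)
        atTop
        (𝓝 (1 / (k : ℝ) * ∑ l ∈ Finset.Icc 1 k, Multicast.eos μ l (k + 1)
          + Multicast.delta1 μ k + Multicast.delta2 μ k)) := by
  open Multicast in
  let e := priorityThen i hi
  -- Measurable versions of the service times; almost surely all of the countably many agree with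
  -- the originals.
  let X' : Fin n → ℕ → Ω → ℝ := fun r j => (hX_law r j).aemeasurable.mk (X r j)
  have hX' : ∀ r j, Measurable (X' r j) := fun r j => (hX_law r j).aemeasurable.measurable_mk
  have hae : ∀ r j, X r j =ᵐ[P] X' r j := fun r j => (hX_law r j).aemeasurable.ae_eq_mk
  have hlaw : ∀ r j, P.map (X' r j) = μ := fun r j => by
    rw [← Measure.map_congr (hae r j), (hX_law r j).map_eq]
  have hind : iIndepFun (fun p : ℕ × Fin (k + 1) => X' (e p.2) p.1) P := by
    have h := hX_indep.congr fun p : Fin n × ℕ => hae p.1 p.2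
    exact h.precomp (g := fun p : ℕ × Fin (k + 1) => (e p.2, p.1)) fun p q hpq =>
      Prod.ext (Prod.mk.inj hpq).2 (priorityThen_injective (Prod.mk.inj hpq).1)
  let C : ℕ → Ω → Fin (k + 1) → ℝ := fun j ω r => X' (e r) j ω
  have hC : ∀ j, Measurable (C j) := fun j => measurable_pi_lambda _ fun r => hX' (e r) j
  have hCind : iIndepFun C P :=
    iIndepFun_column (Z := fun r => X' (e r)) (fun r => hX' (e r)) (fun r => hlaw (e r)) hind
  have hClaw : ∀ j, P.map (C j) = Measure.pi fun _ => μ :=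
    map_column_eq_pi (Z := fun r => X' (e r)) (fun r => hX' (e r)) (fun r => hlaw (e r)) hind
  let d : (Fin (k + 1) → ℝ) → ℝ := fun x =>
    if x (Fin.last k) ≤ maxOthers (Fin.last k) x then 1 else 0
  have hy := measurable_maxOthers (Fin.last k)
  have hy2 := memLp_maxOthers hμ_sq hk (Fin.last k)
  have hd : Measurable d := Measurable.ite
    (measurableSet_le (measurable_pi_apply _) hy) measurable_const measurable_const
  have hm2 := memLp_min_maxOthers hμ_sq hk (Fin.last k)
  have hm₁ := eos_self_pos hμ_nonneg hμ_sq hk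
  rw [eos_self hk] at hm₁
  have hk0 : (0 : ℝ) < k := by exact_mod_cast hk
  have hq : 0 < ∫ x, d x ∂(Measure.pi fun _ : Fin (k + 1) => μ) := by
    have h := integral_indicator_le_maxOthers (μ := μ) hk
    exact pos_of_mul_pos_right (h.symm ▸ hk0) (by positivity)
  have hnn : ∀ᵐ ω ∂P, ∀ r j, 0 ≤ X' r j ω := ae_all_iff.2 fun r => ae_all_iff.2 fun j => by
    have h : ∀ᵐ s ∂(P.map (X' r j)), 0 ≤ s := by rw [hlaw]; exact hμ_nonneg
    exact ae_of_ae_map (hX' r j).aemeasurable h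
  have heq : ∀ᵐ ω ∂P, ∀ r j, X r j ω = X' r j ω := ae_all_iff.2 fun r => ae_all_iff.2 (hae r)
  filter_upwards [hnn, heq,
    ae_tendsto_sum_comp_div hC hCind hClaw hy (hy2.integrable one_le_two),
    ae_tendsto_sum_comp_div hC hCind hClaw (hy.pow_const 2) hy2.integrable_sq,
    ae_tendsto_sum_comp_div hC hCind hClaw hd (integrable_indicator_le_maxOthers (Fin.last k)),
    ae_tendsto_sum_ageAtStamp_mul hC hCind hClaw hy hd ((measurable_pi_apply _).min hy) hy2 hm2
      (fun c => by simp only [d]; split_ifs <;> norm_num)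
      (fun c => by simp only [d]; split_ifs <;> norm_num) hq] with ω h0 h1 h2 h3 h4 h5
  have hx : (fun i j => X i j ω) = fun i j => X' i j ω := by
    ext r j
    exact h1 r j
  rw [hx]
  have hlast : ∀ j, C j ω (Fin.last k) = X' i j ω := fun j =>
    congrArg (fun r => X' r j ω) priorityThen_last
  have hY : ∀ j, maxOthers (Fin.last k) (C j ω) = serviceInterval k (fun i j => X' i j ω) j :=
    fun j => (serviceInterval_eq_maxOthers (hi := hi) (fun i j => X' i j ω) j).symm
  have hD : ∀ j, d (C j ω) = deliveryIndicator k (fun i j => X' i j ω) i j := fun j => by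
    simp only [d, deliveryIndicator, hlast, hY]
  simp only [hY] at h2 h3
  simp only [hD] at h4
  simp only [hY, hD, hlast] at h5
  rw [← average_age_eq hμ_nonneg hμ_sq hk]
  exact tendsto_average_age h0 (ha ω) hm₁ hq h2 h3 h4 h5
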